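/- Let $n\in\mathbb{N}$. For $\beta>-1$ let $H_{n,n}^{(\beta)}$ denote the diagonal Laguerre-Hermite multiple orthogonal polynomial (of type II), that is, the monic real polynomial of degree $2n$ such that $$\int_{-\infty}^{0}x^kH_{n,n}^{(\beta)}(x)\,|x|^{\beta}e^{-x^2}\,dx=0\quad\text{and}\quad\int_{0}^{\infty}x^kH_{n,n}^{(\beta)}(x)\,x^{\beta}e^{-x^2}\,dx=0,\qquad k=0,\ldots,n-1.$$ For every $\beta>-1$ this polynomial exists and is unique, and it has exactly $n$ distinct negative zeros $x_1(\beta)<\cdots<x_n(\beta)$ and exactly $n$ distinct positive zeros $y_1(\beta)<\cdots<y_n(\beta)$. For each $j=1,\ldots,n$, the negative zero $x_j(\beta)$ is a strictly decreasing function of $\beta\in(-1,\infty)$, and the positive zero $y_j(\beta)$ is a strictly increasing function of $\beta\in(-1,\infty)$. -/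

import Mathlib

/-- `P` is the type II multiple orthogonal polynomial of Laguerre-Hermite type for the multi-index
`(n, m)` and the parameter `β`: it is monic of degree `n + m`, it is orthogonal to `1, …, x ^ (n - 1)`
for the weight `|x| ^ β * exp (-x ^ 2)` on `(-∞, 0]`, and to `1, …, x ^ (m - 1)` for the weight
`x ^ β * exp (-x ^ 2)` on `[0, ∞)`. For `β > -1`, the only case of interest, all these integrals
converge absolutely. -/
structure IsLaguerreHermite (n m : ℕ) (β : ℝ) (P : Polynomial ℝ) : Prop where
  monic : P.Monic
  natDegree_eq : P.natDegree = n + m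
  orthogonal_neg : ∀ k < n,
    ∫ x in Set.Iic (0 : ℝ), x ^ k * P.eval x * (|x| ^ β * Real.exp (-x ^ 2)) = 0
  orthogonal_pos : ∀ k < m,
    ∫ x in Set.Ici (0 : ℝ), x ^ k * P.eval x * (x ^ β * Real.exp (-x ^ 2)) = 0

/-! The polynomial is even: it equals `R (x ^ 2)` with `R` monic of degree `n`. Substituting `u = x
^ 2` turns both families of conditions into the vanishing of the moments of `R` against `u ^ (s - 1)
* exp (-u)` at `s = (β + 1 + k) / 2`, `k < n`. By parts, `rodriguesStep a` multiplies the moment at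
`s` by `s - a`, so applying it to `1` for these values `a = s` gives `R`.

By Rolle each step creates positive zeros interlacing the old ones, and a new zero `t` solves `t - ∑
t / (t - z i) = a`. Comparing two such equations shows that `t` grows with `a` and with the `z i`;
hence, by induction, the zeros of `R` increase with `β`, and the zeros sought are `±` their square
roots. Uniqueness, by a Gamma function determinant argument, identifies any solution with this one.
-/

open Polynomial

/-! ### The raising operator -/

/-- The operator `f ↦ (X - a) f - X f'`, which on the half line equals
`- x ^ (1 - a) * exp x * (x ^ a * exp (-x) * f)'`. -/
noncomputable def rodriguesStep (a : ℝ) (F : ℝ[X]) : ℝ[X] :=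
  (X - C a) * F - X * derivative F

theorem eval_rodriguesStep (a t : ℝ) (F : ℝ[X]) :
    (rodriguesStep a F).eval t = (t - a) * F.eval t - t * (derivative F).eval t := by
  simp [rodriguesStep]

theorem degree_X_mul_derivative_lt {F : ℝ[X]} (a : ℝ) (hF : F.Monic) :
    (X * derivative F).degree < ((X - C a) * F).degree := by
  have h0 : F.degree ≠ ⊥ := by simpa [degree_eq_bot] using hF.ne_zero
  rw [degree_mul, degree_mul, degree_X, degree_X_sub_C]
  have := degree_derivative_lt hF.ne_zero
  exact WithBot.add_lt_add_left (by simp) this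

theorem monic_rodriguesStep {F : ℝ[X]} (a : ℝ) (hF : F.Monic) : (rodriguesStep a F).Monic :=
  ((monic_X_sub_C a).mul hF).sub_of_left (degree_X_mul_derivative_lt a hF)

theorem natDegree_rodriguesStep {F : ℝ[X]} (a : ℝ) (hF : F.Monic) :
    (rodriguesStep a F).natDegree = F.natDegree + 1 := by
  rw [rodriguesStep, natDegree_eq_of_degree_eq
    (degree_sub_eq_left_of_degree_lt (degree_X_mul_derivative_lt a hF)),
    (monic_X_sub_C a).natDegree_mul hF, natDegree_X_sub_C, add_comm]

/-- A monic polynomial is the product of the linear factors of as many distinct roots as its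
degree. -/
theorem eq_prod_X_sub_C_of_injective {N : ℕ} {P : ℝ[X]} (hP : P.Monic) (hN : P.natDegree = N)
    {t : Fin N → ℝ} (ht : Function.Injective t) (hroot : ∀ i, P.eval (t i) = 0) :
    P = ∏ i, (X - C (t i)) := by
  have hm : (∏ i, (X - C (t i))).Monic := monic_prod_of_monic _ _ fun i _ => monic_X_sub_C _
  have hd : (∏ i, (X - C (t i))).natDegree = N := by
    rw [natDegree_prod_of_monic _ _ fun i _ => monic_X_sub_C _]; simp
  by_contra hne
  have hlt : (P - ∏ i, (X - C (t i))).degree < P.degree := by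
    refine degree_sub_lt_left ?_ hP.ne_zero (by rw [hP, hm])
    rw [degree_eq_natDegree hP.ne_zero, degree_eq_natDegree hm.ne_zero, hN, hd]
  refine hne (sub_eq_zero.1 ?_)
  refine eq_zero_of_natDegree_lt_card_of_eval_eq_zero _ ht (fun i => ?_) ?_
  · rw [eval_sub, hroot, eval_prod, Finset.prod_eq_zero (Finset.mem_univ i) (by simp), sub_zero]
  · have := natDegree_lt_natDegree (sub_ne_zero.2 hne) hlt
    simpa [hN] using this

theorem eval_derivative_prod_X_sub_C {m : ℕ} (z : Fin m → ℝ) {t : ℝ} (ht : ∀ i, t ≠ z i) :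
    (derivative (∏ i, (X - C (z i)))).eval t =
      (∏ i, (t - z i)) * ∑ i, (t - z i)⁻¹ := by
  classical
  rw [derivative_prod_finset, eval_finsetSum, Finset.mul_sum]
  refine Finset.sum_congr rfl fun i _ => ?_
  have : t - z i ≠ 0 := sub_ne_zero.2 (ht i)
  rw [← Finset.mul_prod_erase _ _ (Finset.mem_univ i)]
  simp [eval_prod]
  field_simp

/-- The zeros of `rodriguesStep a F`, away from those of `F`, solve `t - ∑ t / (t - z i) = a`. -/
theorem eq_of_isRoot_rodriguesStep {m : ℕ} {z : Fin m → ℝ} {a t : ℝ} (ht : ∀ i, t ≠ z i)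
    (h : (rodriguesStep a (∏ i, (X - C (z i)))).eval t = 0) :
    t - ∑ i, t / (t - z i) = a := by
  rw [eval_rodriguesStep, eval_derivative_prod_X_sub_C z ht, eval_prod] at h
  simp only [eval_sub, eval_X, eval_C] at h
  have h0 : ∏ i, (t - z i) ≠ 0 := Finset.prod_ne_zero_iff.2 fun i _ => sub_ne_zero.2 (ht i)
  have h1 : (∏ i, (t - z i)) * (t - a - ∑ i, t / (t - z i)) = 0 := by
    simp only [div_eq_mul_inv, ← Finset.mul_sum]
    linarith
  have := (mul_eq_zero.1 h1).resolve_left h0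
  linarith

/-! ### Location and interlacing of zeros -/

theorem hasDerivAt_rpow_mul_exp_mul_eval {a t : ℝ} (F : ℝ[X]) (ht : 0 < t) :
    HasDerivAt (fun x : ℝ => x ^ a * Real.exp (-x) * F.eval x)
      (-(t ^ (a - 1) * Real.exp (-t) * (rodriguesStep a F).eval t)) t := by
  have h1 := Real.hasDerivAt_rpow_const (p := a) (Or.inl ht.ne')
  have h2 : HasDerivAt (fun x : ℝ => Real.exp (-x)) (-Real.exp (-t)) t := by
    simpa using (hasDerivAt_neg t).exp
  refine ((h1.mul h2).mul (F.hasDerivAt t)).congr_deriv ?_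
  have h3 : t ^ a = t ^ (a - 1) * t := by
    rw [← Real.rpow_add_one ht.ne', sub_add_cancel]
  simp only [eval_rodriguesStep, Pi.mul_apply, h3]
  ring

/-- Rolle's theorem for `x ^ a * exp (-x) * F`; since `0 < a`, the origin serves as an extra zero.
-/
theorem exists_root_rodriguesStep_Ioo {a c d : ℝ} (ha : 0 < a) (F : ℝ[X]) (hc : 0 ≤ c)
    (hcd : c < d) (hFc : c = 0 ∨ F.eval c = 0) (hFd : F.eval d = 0) :
    ∃ t ∈ Set.Ioo c d, (rodriguesStep a F).eval t = 0 := by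
  obtain ⟨t, ht, h⟩ := exists_hasDerivAt_eq_zero
    (f := fun x : ℝ => x ^ a * Real.exp (-x) * F.eval x)
    (f' := fun t => -(t ^ (a - 1) * Real.exp (-t) * (rodriguesStep a F).eval t)) hcd
    (by
      refine Continuous.continuousOn ?_
      exact ((Real.continuous_rpow_const ha.le).mul (by fun_prop)).mul F.continuous)
    (by
      rcases hFc with h | h
      · simp [h, hFd, Real.zero_rpow ha.ne']
      · simp [h, hFd])
    (fun x hx => hasDerivAt_rpow_mul_exp_mul_eval F (hc.trans_lt hx.1))
  refine ⟨t, ht, ?_⟩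
  have h0 : 0 < t := hc.trans_lt ht.1
  have := (Real.rpow_pos_of_pos h0 (a - 1)).ne'
  simpa [this, Real.exp_ne_zero] using h

theorem exists_root_rodriguesStep_Ioi {a c : ℝ} {F : ℝ[X]} (hF : F.Monic)
    (hc : (rodriguesStep a F).eval c < 0) :
    ∃ t, c < t ∧ (rodriguesStep a F).eval t = 0 := by
  have hm := monic_rodriguesStep a hF
  have hd : 0 < (rodriguesStep a F).degree := by
    rw [← natDegree_pos_iff_degree_pos, natDegree_rodriguesStep a hF]; omega
  have ht := tendsto_atTop_of_leadingCoeff_nonneg _ hd (by rw [hm]; norm_num)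
  obtain ⟨M, hM, hcM⟩ :=
    ((ht.eventually_gt_atTop 0).and (Filter.eventually_gt_atTop c)).exists
  obtain ⟨t, ht, h⟩ := intermediate_value_Ioo hcM.le
    (rodriguesStep a F).continuous.continuousOn ⟨hc, hM⟩
  exact ⟨t, ht.1, h⟩

/-- At the largest zero of `F` only `-t * F' t` survives, and `F'` is positive there; with no zeros
the value at `0` is `-a`. This yields the sign change beyond the last zero, where Rolle gives
nothing. -/
theorem eval_rodriguesStep_last_neg {a : ℝ} (ha : 0 < a) {m : ℕ} {z : Fin m → ℝ}
    (hz : StrictMono z) (hpos : ∀ i, 0 < z i) :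
    (rodriguesStep a (∏ i, (X - C (z i)))).eval
      ((Fin.cons 0 z : Fin (m + 1) → ℝ) (Fin.last m)) < 0 := by
  cases m with
  | zero => simp [eval_rodriguesStep, ha]
  | succ k =>
    have hl : (Fin.cons 0 z : Fin (k + 2) → ℝ) (Fin.last (k + 1)) = z (Fin.last k) := by
      rw [← Fin.succ_last, Fin.cons_succ]
    rw [hl, eval_rodriguesStep, Fin.prod_univ_castSucc]
    simp only [derivative_mul, eval_mul, eval_add, eval_sub, eval_X, eval_C, derivative_sub,
      derivative_X, derivative_C, sub_self, mul_zero, sub_zero, zero_add, mul_one, zero_sub,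
      Left.neg_neg_iff, eval_prod]
    exact mul_pos (hpos _) (Finset.prod_pos fun i _ => sub_pos.2 (hz (Fin.castSucc_lt_last i)))

/-- `t` interlaces `z`, with one more point on each side. -/
def Interlaces {m : ℕ} (t : Fin (m + 1) → ℝ) (z : Fin m → ℝ) : Prop :=
  ∀ (i : Fin m) (j : Fin (m + 1)),
    (i.castSucc < j → z i < t j) ∧ (j ≤ i.castSucc → t j < z i)

theorem exists_zeros_rodriguesStep {a : ℝ} (ha : 0 < a) {m : ℕ} {z : Fin m → ℝ}
    (hz : StrictMono z) (hpos : ∀ i, 0 < z i) :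
    ∃ t : Fin (m + 1) → ℝ, StrictMono t ∧ (∀ j, 0 < t j) ∧ Interlaces t z ∧
      rodriguesStep a (∏ i, (X - C (z i))) = ∏ j, (X - C (t j)) := by
  set F : ℝ[X] := ∏ i, (X - C (z i)) with hFdef
  -- The left ends of the `m + 1` gaps, the last of which is unbounded.
  set c : Fin (m + 1) → ℝ := Fin.cons 0 z with hcdef
  have hF : F.Monic := monic_prod_of_monic _ _ fun i _ => monic_X_sub_C _
  have hFd : F.natDegree = m := by
    rw [hFdef, natDegree_prod_of_monic _ _ fun i _ => monic_X_sub_C _]; simp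
  have hFz : ∀ i, F.eval (z i) = 0 := fun i => by
    rw [hFdef, eval_prod, Finset.prod_eq_zero (Finset.mem_univ i) (by simp)]
  have hc0 : ∀ j, 0 ≤ c j := by
    refine Fin.cases le_rfl fun i => ?_
    simpa [hcdef] using (hpos i).le
  have hFc : ∀ j, c j = 0 ∨ F.eval (c j) = 0 := by
    refine Fin.cases (Or.inl rfl) fun i => Or.inr ?_
    simpa [hcdef] using hFz i
  have hcz : ∀ i : Fin m, c i.castSucc < z i := by
    intro i
    have hcm : StrictMono c := by
      refine Fin.strictMono_iff_lt_succ.2 fun i => ?_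
      cases m with
      | zero => exact i.elim0
      | succ k =>
        refine Fin.cases ?_ (fun i => ?_) i
        · simpa [hcdef] using hpos 0
        · simpa [hcdef, ← Fin.succ_castSucc] using hz (Fin.castSucc_lt_succ (i := i))
    simpa [hcdef] using hcm (Fin.castSucc_lt_succ (i := i))
  have hex : ∀ j : Fin (m + 1), ∃ t, c j < t ∧ (∀ i : Fin m, j = i.castSucc → t < z i) ∧
      (rodriguesStep a F).eval t = 0 := by
    refine Fin.lastCases ?_ fun i => ?_
    · obtain ⟨t, h1, h2⟩ :=
        exists_root_rodriguesStep_Ioi hF (eval_rodriguesStep_last_neg ha hz hpos)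
      exact ⟨t, h1, fun i hi => absurd hi (Fin.castSucc_lt_last i).ne', h2⟩
    · obtain ⟨t, h1, h2⟩ := exists_root_rodriguesStep_Ioo ha F (hc0 i.castSucc) (hcz i)
        (hFc _) (hFz i)
      refine ⟨t, h1.1, fun k hk => ?_, h2⟩
      rw [← Fin.castSucc_injective _ hk]
      exact h1.2
  choose t ht1 ht2 ht3 using hex
  have hsucc : ∀ i : Fin m, z i < t i.succ := fun i => by simpa [hcdef] using ht1 i.succ
  have hcast : ∀ i : Fin m, t i.castSucc < z i := fun i => ht2 _ i rfl
  have htm : StrictMono t := Fin.strictMono_iff_lt_succ.2 fun i => (hcast i).trans (hsucc i)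
  refine ⟨t, htm, fun j => (hc0 j).trans_lt (ht1 j), fun i j => ⟨fun h => ?_, fun h => ?_⟩, ?_⟩
  · exact (hsucc i).trans_le (htm.monotone (Fin.castSucc_lt_iff_succ_le.1 h))
  · exact (htm.monotone h).trans_lt (hcast i)
  · exact eq_prod_X_sub_C_of_injective (monic_rodriguesStep a hF)
      (by rw [natDegree_rodriguesStep a hF, hFd]) htm.injective ht3

/-! ### Monotonicity of the zeros -/

/-- The zeros of `rodriguesStep a F` increase strictly with `a` and weakly with the zeros of `F`. -/
theorem zeros_rodriguesStep_lt {a b : ℝ} (hab : a < b) {m : ℕ} {z w : Fin m → ℝ}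
    (hzw : ∀ i, z i ≤ w i) (hz : ∀ i, 0 < z i)
    {t u : Fin (m + 1) → ℝ} (hu : ∀ j, 0 < u j)
    (htz : Interlaces t z) (huw : Interlaces u w)
    (ht : ∀ j, (rodriguesStep a (∏ i, (X - C (z i)))).eval (t j) = 0)
    (hu' : ∀ j, (rodriguesStep b (∏ i, (X - C (w i)))).eval (u j) = 0) (j : Fin (m + 1)) :
    t j < u j := by
  by_contra! h
  -- If `u j ≤ t j`, interlacing for one pair gives the sign of its factor, and `z i ≤ w i` carries
  -- it to the other.
  have hside : ∀ i, 0 < (t j - z i) * (u j - w i) := fun i => by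
    rcases lt_or_ge i.castSucc j with hij | hij
    · have := (huw i j).1 hij
      have := hzw i
      exact mul_pos (by linarith) (by linarith)
    · have := (htz i j).2 hij
      have := hzw i
      exact mul_pos_of_neg_of_neg (by linarith) (by linarith)
  have htne : ∀ i, t j - z i ≠ 0 := fun i => left_ne_zero_of_mul (hside i).ne'
  have hune : ∀ i, u j - w i ≠ 0 := fun i => right_ne_zero_of_mul (hside i).ne'
  have h1 := eq_of_isRoot_rodriguesStep (fun i => sub_ne_zero.1 (htne i)) (ht j)
  have h2 := eq_of_isRoot_rodriguesStep (fun i => sub_ne_zero.1 (hune i)) (hu' j)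
  have h3 : ∑ i, t j / (t j - z i) ≤ ∑ i, u j / (u j - w i) := by
    refine Finset.sum_le_sum fun i _ => ?_
    have key : u j / (u j - w i) - t j / (t j - z i) =
        (t j * w i - u j * z i) / ((t j - z i) * (u j - w i)) := by
      have := htne i
      have := hune i
      field_simp
      ring
    have : 0 ≤ (t j * w i - u j * z i) / ((t j - z i) * (u j - w i)) := by
      refine div_nonneg (sub_nonneg.2 ?_) (hside i).le
      exact mul_le_mul h (hzw i) (hz i).le ((hu j).le.trans h)
    linarith
  linarith

/-- Iterating `rodriguesStep` with parameters `(β + 1) / 2, (β + 2) / 2, …, (β + m) / 2`. -/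
noncomputable def rodriguesPoly (β : ℝ) : ℕ → ℝ[X]
  | 0 => 1
  | m + 1 => rodriguesStep ((β + 1 + m) / 2) (rodriguesPoly β m)

theorem monic_rodriguesPoly (β : ℝ) (m : ℕ) : (rodriguesPoly β m).Monic := by
  induction m with
  | zero => exact monic_one
  | succ m ih => exact monic_rodriguesStep _ ih

theorem natDegree_rodriguesPoly (β : ℝ) (m : ℕ) : (rodriguesPoly β m).natDegree = m := by
  induction m with
  | zero => exact natDegree_one
  | succ m ih => rw [rodriguesPoly, natDegree_rodriguesStep _ (monic_rodriguesPoly β m), ih]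

theorem exists_zeros_rodriguesPoly (m : ℕ) :
    ∃ z : Fin m → ℝ → ℝ,
      (∀ β, -1 < β → StrictMono (fun j => z j β) ∧ (∀ j, 0 < z j β) ∧
        rodriguesPoly β m = ∏ j, (X - C (z j β))) ∧
      ∀ j, StrictMonoOn (z j) (Set.Ioi (-1)) := by
  induction m with
  | zero =>
    exact ⟨fun j => j.elim0, fun β _ => ⟨fun i => i.elim0, fun i => i.elim0, by
      simp [rodriguesPoly]⟩, fun j => j.elim0⟩
  | succ m ih =>
    obtain ⟨z, hz, hmono⟩ := ih
    have hex : ∀ β : ℝ, ∃ t : Fin (m + 1) → ℝ, -1 < β →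
        StrictMono t ∧ (∀ j, 0 < t j) ∧ Interlaces t (fun i => z i β) ∧
        rodriguesStep ((β + 1 + m) / 2) (∏ i, (X - C (z i β))) = ∏ j, (X - C (t j)) := by
      intro β
      by_cases hβ : -1 < β
      · have ha : 0 < (β + 1 + m) / 2 := by
          have : (0 : ℝ) ≤ m := m.cast_nonneg
          linarith
        obtain ⟨t, ht⟩ := exists_zeros_rodriguesStep ha (hz β hβ).1 (hz β hβ).2.1
        exact ⟨t, fun _ => ht⟩
      -- A junk value outside the parameter range, so that `t` is defined on all of `ℝ`.
      · exact ⟨0, fun h => absurd h hβ⟩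
    choose t ht using hex
    have hroot : ∀ β, -1 < β → ∀ j,
        (rodriguesStep ((β + 1 + m) / 2) (∏ i, (X - C (z i β)))).eval (t β j) = 0 := by
      intro β hβ j
      rw [(ht β hβ).2.2.2, eval_prod, Finset.prod_eq_zero (Finset.mem_univ j) (by simp)]
    refine ⟨fun j β => t β j, fun β hβ => ⟨(ht β hβ).1, (ht β hβ).2.1, ?_⟩, fun j β hβ γ hγ h => ?_⟩
    · rw [rodriguesPoly, (hz β hβ).2.2, (ht β hβ).2.2.2]
    · exact zeros_rodriguesStep_lt (by linarith) (fun i => (hmono i hβ hγ h).le) (hz β hβ).2.1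
        (ht γ hγ).2.1 (ht β hβ).2.2.1 (ht γ hγ).2.2.1 (hroot β hβ) (hroot γ hγ) j

/-! ### Gamma moments and the integrals -/

theorem Gamma_add_natCast {s : ℝ} (hs : 0 < s) (n : ℕ) :
    Real.Gamma (s + n) = Real.Gamma s * (ascPochhammer ℝ n).eval s := by
  induction n with
  | zero => simp
  | succ n ih =>
    have : s + n ≠ 0 := by positivity
    rw [Nat.cast_succ, ← add_assoc, Real.Gamma_add_one this, ih, ascPochhammer_succ_eval]
    ring

/-- The functional `X ^ j ↦ Γ (s + j)`, that is, integration against `x ^ (s - 1) * exp (-x)`. -/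
noncomputable def gammaMoment (s : ℝ) : ℝ[X] →ₗ[ℝ] ℝ :=
  Polynomial.lsum fun j => Real.Gamma (s + j) • LinearMap.id

theorem gammaMoment_monomial (s : ℝ) (j : ℕ) (c : ℝ) :
    gammaMoment s (monomial j c) = Real.Gamma (s + j) * c := by
  simp [gammaMoment, Polynomial.lsum]

theorem gammaMoment_eq_sum (s : ℝ) {F : ℝ[X]} {N : ℕ} (hN : F.natDegree < N) :
    gammaMoment s F = ∑ j ∈ Finset.range N, F.coeff j * Real.Gamma (s + j) := by
  conv_lhs => rw [F.as_sum_range' N hN]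
  simp [gammaMoment_monomial, mul_comm]

/-- Dividing row `k` by `Γ (b k)` leaves a combination of rising factorials, a polynomial of degree
below `n` with `n` distinct zeros `b k`. -/
theorem eq_zero_of_sum_mul_Gamma_eq_zero {n : ℕ} {b c : ℕ → ℝ} (hb : Function.Injective b)
    (hpos : ∀ k, 0 < b k)
    (h : ∀ k < n, ∑ i ∈ Finset.range n, c i * Real.Gamma (b k + i) = 0) :
    ∀ i < n, c i = 0 := by
  let S : Polynomial.Sequence ℝ := ⟨ascPochhammer ℝ, fun i => by
    rw [degree_eq_natDegree (monic_ascPochhammer ℝ i).ne_zero, ascPochhammer_natDegree]⟩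
  have hp : ∑ i ∈ Finset.range n, c i • S i = 0 := by
    refine eq_zero_of_degree_lt_of_eval_index_eq_zero (Finset.range n) (v := b) hb.injOn ?_ ?_
    · rw [Finset.card_range]
      refine mem_degreeLT.1 (Submodule.sum_mem _ fun i hi => mem_degreeLT.2 ?_)
      refine (degree_smul_le _ _).trans_lt ?_
      rw [S.degree_eq]
      exact_mod_cast Finset.mem_range.1 hi
    · intro k hk
      have h1 := h k (Finset.mem_range.1 hk)
      simp only [Gamma_add_natCast (hpos k), mul_left_comm (c _)] at h1
      rw [← Finset.mul_sum, mul_eq_zero_iff_left (Real.Gamma_pos_of_pos (hpos k)).ne'] at h1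
      simpa [eval_finsetSum, S] using h1
  intro i hi
  exact linearIndependent_iff'.1 S.linearIndependent _ _ hp i (Finset.mem_range.2 hi)

theorem sum_range_two_mul {M : Type*} [AddCommMonoid M] (f : ℕ → M) (n : ℕ) :
    ∑ j ∈ Finset.range (2 * n), f j =
      ∑ i ∈ Finset.range n, f (2 * i) + ∑ i ∈ Finset.range n, f (2 * i + 1) := by
  induction n with
  | zero => simp
  | succ n ih =>
    rw [Nat.mul_succ, Finset.sum_range_succ, Finset.sum_range_succ, ih, Finset.sum_range_succ,
      Finset.sum_range_succ]
    abel

open MeasureTheory in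
theorem integral_Ici_pow_mul_eval {β : ℝ} (hβ : -1 < β) (k : ℕ) {P : ℝ[X]} {N : ℕ}
    (hN : P.natDegree < N) :
    ∫ x in Set.Ici (0 : ℝ), x ^ k * P.eval x * (x ^ β * Real.exp (-x ^ 2)) =
      (∑ j ∈ Finset.range N, P.coeff j * Real.Gamma ((β + 1 + k) / 2 + j / 2)) / 2 := by
  have hq : ∀ j : ℕ, -1 < β + k + j := fun j => by
    have : (0 : ℝ) ≤ k := k.cast_nonneg
    have : (0 : ℝ) ≤ j := j.cast_nonneg
    linarith
  rw [integral_Ici_eq_integral_Ioi]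
  have h1 : ∀ x ∈ Set.Ioi (0 : ℝ), x ^ k * P.eval x * (x ^ β * Real.exp (-x ^ 2)) =
      ∑ j ∈ Finset.range N, P.coeff j * (x ^ (β + k + j) * Real.exp (-x ^ (2 : ℝ))) := by
    intro x hx
    rw [eval_eq_sum_range' hN, Finset.mul_sum, Finset.sum_mul]
    refine Finset.sum_congr rfl fun j _ => ?_
    rw [Real.rpow_add_natCast hx.ne', Real.rpow_add_natCast hx.ne', Real.rpow_two]
    ring
  have h2 : ∀ j ∈ Finset.range N, IntegrableOn
      (fun x : ℝ => P.coeff j * (x ^ (β + k + j) * Real.exp (-x ^ (2 : ℝ)))) (Set.Ioi 0) := by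
    intro j _
    have := integrableOn_rpow_mul_exp_neg_mul_rpow (hq j) two_pos one_pos
    simp only [neg_mul, one_mul] at this
    exact this.const_mul _
  rw [setIntegral_congr_fun measurableSet_Ioi h1, integral_finsetSum _ h2, Finset.sum_div]
  refine Finset.sum_congr rfl fun j _ => ?_
  rw [integral_const_mul, integral_rpow_mul_exp_neg_rpow two_pos (hq j)]
  ring_nf

theorem natDegree_comp_neg_X (P : ℝ[X]) : (P.comp (-X)).natDegree = P.natDegree := by
  simp [natDegree_comp]

theorem coeff_comp_neg_X (P : ℝ[X]) (j : ℕ) : (P.comp (-X)).coeff j = (-1) ^ j * P.coeff j := by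
  rw [show (-X : ℝ[X]) = C (-1) * X by simp, comp_C_mul_X_coeff, mul_comm]

open MeasureTheory in
theorem integral_Iic_pow_mul_eval (β : ℝ) (k : ℕ) (P : ℝ[X]) :
    ∫ x in Set.Iic (0 : ℝ), x ^ k * P.eval x * (|x| ^ β * Real.exp (-x ^ 2)) =
      (-1) ^ k *
        ∫ x in Set.Ici (0 : ℝ), x ^ k * (P.comp (-X)).eval x * (x ^ β * Real.exp (-x ^ 2)) := by
  have h := integral_comp_neg_Iic 0
    (fun x : ℝ => (-x) ^ k * P.eval (-x) * (|(-x)| ^ β * Real.exp (-(-x) ^ 2)))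
  simp only [neg_neg, neg_zero] at h
  rw [h, integral_Ici_eq_integral_Ioi, ← integral_const_mul]
  refine setIntegral_congr_fun measurableSet_Ioi fun x hx => ?_
  simp only [abs_neg, abs_of_pos (show 0 < x from hx), eval_comp, eval_neg, eval_X, neg_sq]
  rw [neg_pow]
  ring

/-! ### Existence -/

/-- Integration by parts in algebraic form: on monomials it is `Γ (s + j + 1) = (s + j) * Γ (s +
j)`. -/
theorem gammaMoment_rodriguesStep {s : ℝ} (hs : 0 < s) (a : ℝ) (F : ℝ[X]) :
    gammaMoment s (rodriguesStep a F) = (s - a) * gammaMoment s F := by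
  induction F using Polynomial.induction_on' with
  | add p q hp hq =>
    have : rodriguesStep a (p + q) = rodriguesStep a p + rodriguesStep a q := by
      simp only [rodriguesStep, derivative_add]; ring
    rw [this, map_add, map_add, hp, hq, mul_add]
  | monomial j c =>
    have h : rodriguesStep a (monomial j c) =
        monomial (j + 1) c - monomial j (a * c) - monomial j (j * c) := by
      rw [rodriguesStep, sub_mul, X_mul_monomial, C_mul_monomial, derivative_monomial]
      cases j with
      | zero => simp
      | succ j => rw [Nat.add_sub_cancel, X_mul_monomial, mul_comm c]
    have hj : s + j ≠ 0 := by positivity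
    rw [h, map_sub, map_sub, gammaMoment_monomial, gammaMoment_monomial, gammaMoment_monomial,
      gammaMoment_monomial, Nat.cast_succ, ← add_assoc, Real.Gamma_add_one hj]
    ring

theorem gammaMoment_rodriguesPoly_eq_zero {β : ℝ} (hβ : -1 < β) {k m : ℕ} (hk : k < m) :
    gammaMoment ((β + 1 + k) / 2) (rodriguesPoly β m) = 0 := by
  have hs : 0 < (β + 1 + k) / 2 := by
    have : (0 : ℝ) ≤ k := k.cast_nonneg
    linarith
  induction m with
  | zero => omega
  | succ m ih =>
    rw [rodriguesPoly, gammaMoment_rodriguesStep hs]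
    rcases Nat.lt_succ_iff_lt_or_eq.1 hk with h | rfl
    · rw [ih h, mul_zero]
    · rw [sub_self, zero_mul]

theorem isLaguerreHermite_expand_rodriguesPoly (n : ℕ) {β : ℝ} (hβ : -1 < β) :
    IsLaguerreHermite n n β (expand ℝ 2 (rodriguesPoly β n)) := by
  have hpos : ∀ k < n, ∫ x in Set.Ici (0 : ℝ), x ^ k * (expand ℝ 2 (rodriguesPoly β n)).eval x *
      (x ^ β * Real.exp (-x ^ 2)) = 0 := by
    intro k hk
    have hN : (expand ℝ 2 (rodriguesPoly β n)).natDegree < 2 * (n + 1) := by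
      rw [natDegree_expand, natDegree_rodriguesPoly]; omega
    have hd : (rodriguesPoly β n).natDegree < n + 1 := by
      rw [natDegree_rodriguesPoly]; omega
    have h := gammaMoment_rodriguesPoly_eq_zero hβ hk
    rw [gammaMoment_eq_sum _ hd] at h
    have hodd : ∀ i, (expand ℝ 2 (rodriguesPoly β n)).coeff (2 * i + 1) = 0 := fun i => by
      rw [coeff_expand two_pos, if_neg (by omega)]
    rw [integral_Ici_pow_mul_eval hβ k hN, sum_range_two_mul]
    simp only [hodd, coeff_expand_mul' two_pos, zero_mul, Finset.sum_const_zero, add_zero]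
    rw [div_eq_zero_iff, ← h]
    refine Or.inl (Finset.sum_congr rfl fun i _ => ?_)
    rw [Nat.cast_mul, Nat.cast_two, mul_div_cancel_left₀ _ (two_ne_zero' ℝ)]
  refine ⟨(monic_rodriguesPoly β n).expand two_pos, ?_, fun k hk => ?_, hpos⟩
  · rw [natDegree_expand, natDegree_rodriguesPoly]; ring
  · have heven : (expand ℝ 2 (rodriguesPoly β n)).comp (-X) = expand ℝ 2 (rodriguesPoly β n) := by
      rw [expand_eq_comp_X_pow, comp_assoc]; simp
    rw [integral_Iic_pow_mul_eval, heven, hpos k hk, mul_zero]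

/-! ### Uniqueness -/

theorem IsLaguerreHermite.unique {n : ℕ} {β : ℝ} (hβ : -1 < β) {P Q : ℝ[X]}
    (hP : IsLaguerreHermite n n β P) (hQ : IsLaguerreHermite n n β Q) : P = Q := by
  have hdeg : ∀ R, IsLaguerreHermite n n β R → R.natDegree < 2 * n + 1 := fun R hR => by
    rw [hR.natDegree_eq]; omega
  have hlead : ∀ R, IsLaguerreHermite n n β R → R.coeff (2 * n) = 1 := fun R hR => by
    rw [two_mul, ← hR.natDegree_eq]; exact hR.monic
  set d : ℕ → ℝ := fun j => P.coeff j - Q.coeff j with hd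
  -- Monicity removes the top coefficient, leaving `2 * n` unknowns for `2 * n` equations.
  have hd2n : d (2 * n) = 0 := by simp [hd, hlead P hP, hlead Q hQ]
  have hplus : ∀ k < n,
      ∑ j ∈ Finset.range (2 * n), d j * Real.Gamma ((β + 1 + k) / 2 + j / 2) = 0 := by
    intro k hk
    have h1 := hP.orthogonal_pos k hk
    have h2 := hQ.orthogonal_pos k hk
    rw [integral_Ici_pow_mul_eval hβ k (hdeg P hP)] at h1
    rw [integral_Ici_pow_mul_eval hβ k (hdeg Q hQ)] at h2
    have h3 : ∑ j ∈ Finset.range (2 * n + 1), d j * Real.Gamma ((β + 1 + k) / 2 + j / 2) = 0 := by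
      simp only [hd, sub_mul, Finset.sum_sub_distrib]
      linarith
    rwa [Finset.sum_range_succ, hd2n, zero_mul, add_zero] at h3
  have hminus : ∀ k < n, ∑ j ∈ Finset.range (2 * n),
      (-1) ^ j * d j * Real.Gamma ((β + 1 + k) / 2 + j / 2) = 0 := by
    intro k hk
    have h1 := hP.orthogonal_neg k hk
    have h2 := hQ.orthogonal_neg k hk
    have hk1 : (-1 : ℝ) ^ k ≠ 0 := by simp
    rw [integral_Iic_pow_mul_eval, integral_Ici_pow_mul_eval hβ k
      ((natDegree_comp_neg_X P).trans_lt (hdeg P hP)), mul_eq_zero_iff_left hk1] at h1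
    rw [integral_Iic_pow_mul_eval, integral_Ici_pow_mul_eval hβ k
      ((natDegree_comp_neg_X Q).trans_lt (hdeg Q hQ)), mul_eq_zero_iff_left hk1] at h2
    simp only [coeff_comp_neg_X] at h1 h2
    have h3 : ∑ j ∈ Finset.range (2 * n + 1),
        (-1) ^ j * d j * Real.Gamma ((β + 1 + k) / 2 + j / 2) = 0 := by
      simp only [hd, mul_sub, sub_mul, Finset.sum_sub_distrib]
      linarith
    rwa [Finset.sum_range_succ, hd2n, mul_zero, zero_mul, add_zero] at h3
  -- Adding and subtracting the two half-line conditions decouples even and odd coefficients into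
  -- two `n × n` Gamma systems.
  have hsplit : ∀ k < n,
      ∑ i ∈ Finset.range n, d (2 * i) * Real.Gamma ((β + 1 + k) / 2 + i) = 0 ∧
      ∑ i ∈ Finset.range n, d (2 * i + 1) * Real.Gamma ((β + 1 + k) / 2 + 1 / 2 + i) = 0 := by
    intro k hk
    have h1 := hplus k hk
    have h2 := hminus k hk
    rw [sum_range_two_mul] at h1 h2
    have he : ∀ i : ℕ, ((2 * i : ℕ) : ℝ) / 2 = i := fun i => by push_cast; ring
    have ho : ∀ i : ℕ, (β + 1 + k) / 2 + ((2 * i + 1 : ℕ) : ℝ) / 2 =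
        (β + 1 + k) / 2 + 1 / 2 + i := fun i => by push_cast; ring
    simp only [pow_add, pow_mul, pow_one, neg_one_sq, one_pow, one_mul, neg_mul, he, ho,
      Finset.sum_neg_distrib] at h1 h2
    constructor <;> linarith
  have hpos : ∀ k : ℕ, 0 < (β + 1 + k) / 2 := fun k => by
    have : (0 : ℝ) ≤ k := k.cast_nonneg
    linarith
  have heven := eq_zero_of_sum_mul_Gamma_eq_zero (b := fun k => (β + 1 + k) / 2)
    (c := fun i => d (2 * i))
    (fun i j h => by simpa using h) hpos fun k hk => (hsplit k hk).1
  have hodd := eq_zero_of_sum_mul_Gamma_eq_zero (b := fun k => (β + 1 + k) / 2 + 1 / 2)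
    (c := fun i => d (2 * i + 1))
    (fun i j h => by simpa using h) (fun k => by linarith [hpos k]) fun k hk => (hsplit k hk).2
  ext j
  refine sub_eq_zero.1 (show d j = 0 from ?_)
  rcases lt_trichotomy j (2 * n) with hj | rfl | hj
  · rcases Nat.even_or_odd' j with ⟨i, rfl | rfl⟩
    · exact heven i (by omega)
    · exact hodd i (by omega)
  · exact hd2n
  · simp only [hd]
    rw [coeff_eq_zero_of_natDegree_lt, coeff_eq_zero_of_natDegree_lt, sub_zero]
    · exact lt_of_lt_of_le (hdeg Q hQ) hj
    · exact lt_of_lt_of_le (hdeg P hP) hj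

/-! ### Back to the original variable -/

theorem isRoot_expand_prod_iff {n : ℕ} {z : Fin n → ℝ} {t : ℝ} :
    (expand ℝ 2 (∏ j, (X - C (z j)))).IsRoot t ↔ ∃ j, t ^ 2 = z j := by
  rw [IsRoot, expand_eval, eval_prod, Finset.prod_eq_zero_iff]
  simp [sub_eq_zero]

theorem mainTheorem3 (n : ℕ) :
    (∀ β : ℝ, -1 < β → ∃! P : Polynomial ℝ, IsLaguerreHermite n n β P) ∧
    ∀ H : ℝ → Polynomial ℝ, (∀ β : ℝ, -1 < β → IsLaguerreHermite n n β (H β)) →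
      ∃ x y : Fin n → ℝ → ℝ,
        (∀ β : ℝ, -1 < β →
          StrictMono (fun j => x j β) ∧ StrictMono (fun j => y j β) ∧
          {t : ℝ | t < 0 ∧ (H β).IsRoot t} = Set.range (fun j => x j β) ∧
          {t : ℝ | 0 < t ∧ (H β).IsRoot t} = Set.range (fun j => y j β)) ∧
        (∀ j : Fin n, StrictAntiOn (x j) (Set.Ioi (-1))) ∧
        (∀ j : Fin n, StrictMonoOn (y j) (Set.Ioi (-1))) := by
  refine ⟨fun β hβ => ⟨_, isLaguerreHermite_expand_rodriguesPoly n hβ, fun Q hQ =>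
    hQ.unique hβ (isLaguerreHermite_expand_rodriguesPoly n hβ)⟩, fun H hH => ?_⟩
  obtain ⟨z, hz, hmono⟩ := exists_zeros_rodriguesPoly n
  have hroot : ∀ β, -1 < β → ∀ t, (H β).IsRoot t ↔ ∃ j, t ^ 2 = z j β := fun β hβ t => by
    rw [(hH β hβ).unique hβ (isLaguerreHermite_expand_rodriguesPoly n hβ), (hz β hβ).2.2,
      isRoot_expand_prod_iff]
  have hsqrt : ∀ j, StrictMonoOn (fun β => √(z j β)) (Set.Ioi (-1)) := fun j β hβ γ hγ h =>
    Real.sqrt_lt_sqrt ((hz β hβ).2.1 j).le (hmono j hβ hγ h)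
  have hsm : ∀ β, -1 < β → StrictMono (fun j => √(z j β)) := fun β hβ i j h =>
    Real.sqrt_lt_sqrt ((hz β hβ).2.1 i).le ((hz β hβ).1 h)
  -- Negation reverses order, hence `j.rev` for the negative zeros.
  refine ⟨fun j β => -√(z j.rev β), fun j β => √(z j β), fun β hβ => ⟨fun i j h => ?_, hsm β hβ,
    ?_, ?_⟩, fun j β hβ γ hγ h => neg_lt_neg (hsqrt j.rev hβ hγ h), hsqrt⟩
  · exact neg_lt_neg (hsm β hβ (Fin.rev_lt_rev.2 h))
  · ext t
    simp only [Set.mem_ofPred_eq, hroot β hβ, Set.mem_range]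
    constructor
    · rintro ⟨ht, j, hj⟩
      exact ⟨j.rev, by rw [Fin.rev_rev, ← hj, Real.sqrt_sq_eq_abs, abs_of_neg ht, neg_neg]⟩
    · rintro ⟨j, rfl⟩
      have := (hz β hβ).2.1 j.rev
      exact ⟨neg_neg_of_pos (Real.sqrt_pos.2 this), j.rev, by rw [neg_sq, Real.sq_sqrt this.le]⟩
  · ext t
    simp only [Set.mem_ofPred_eq, hroot β hβ, Set.mem_range]
    constructor
    · rintro ⟨ht, j, hj⟩
      exact ⟨j, by rw [← hj, Real.sqrt_sq ht.le]⟩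
    · rintro ⟨j, rfl⟩
      have := (hz β hβ).2.1 j
      exact ⟨Real.sqrt_pos.2 this, j, Real.sq_sqrt this.le⟩
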